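/- Let $m\ge 1$, and consider the linear equation with distributed delays $$\dot x(t)+a(t)x(t)+\sum_{k=1}^m b_k(t)\int_{h_k(t)}^t x(s)\,d_sR_k(t,s)=0,\qquad t\ge t_0\ge 0, \tag{E}$$ with initial condition $x(t)=\varphi(t)$ for $t\le t_0$, where $\varphi$ is continuous and bounded on $(-\infty,t_0]$. A solution is a function on $\mathbb R$ that is (locally) absolutely continuous on $[t_0,\infty)$, satisfies the equation for almost every $t\ge t_0$, and equals $\varphi$ on $(-\infty,t_0]$. Assume that - $a,b_1,\dots,b_m$ are Lebesgue measurable and essentially bounded on $[0,\infty)$, $a(t)\ge a_0>0$ and $b_k(t)\ge 0$ for $t\ge0$; - each $h_k$ is Lebesgue measurable, $h_k(t)\le t$ for $t\ge 0$, and $\lim_{t\to\infty}h_k(t)=\infty$; - for each $k$ and almost every $t\ge0$, $R_k(t,\cdot)$ is nondecreasing and $\int_{h_k(t)}^t d_sR_k(t,s)=1$ (these are Lebesgue–Stieltjes integrals over the closed interval $[h_k(t),t]$). Put $b(t)=\sum_{k=1}^m b_k(t)$, and suppose that $$h_0:=\limsup_{t\to\infty}\int_{\min_k h_k(t)}^t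 a(s)\,ds<\infty,\qquad \beta:=\limsup_{t\to\infty}\frac{b(t)}{a(t)}<\infty,$$ $$\frac1\beta e^{-h_0}>\ln\frac{\beta^2+\beta}{\beta^2+1},$$ where the last inequality is regarded as satisfied when $\beta=0$. Then (E) is exponentially stable: there are constants $M>0$ and $\alpha>0$ such that for every $t_0\ge0$ and every bounded continuous $\varphi$ on $(-\infty,t_0]$, each solution $x$ with initial function $\varphi$ satisfies $$|x(t)|\le M\,\|\varphi\|\,e^{-\alpha(t-t_0)},\qquad t\ge t_0,\qquad \|\varphi\|=\sup_{s\le t_0}|\varphi(s)|.$$ -/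

import Mathlib

open MeasureTheory Set Filter Topology
open scoped BoundedContinuousFunction

noncomputable section

open Classical in
/-- The Lebesgue-Stieltjes measure `dF` of a nondecreasing function `F` on the real line. It does
not depend on the values of `F` at its jumps, and `dF [u, v] = F (v+) - F (u-)`.
(It is set to `0` when `F` is not nondecreasing.) -/
def stieltjesMeasure (F : ℝ → ℝ) : Measure ℝ :=
  if hF : Monotone F then hF.stieltjesFunction.measure else 0

/-- `x` is a solution of
`x'(t) + a(t) x(t) + ∑ₖ bₖ(t) ∫_{[hₖ(t), t]} x(s) dₛRₖ(t, s) = 0` for `t ≥ t₀`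
with the initial condition `x(t) = φ(t)` for `t ≤ t₀`: it is (locally) absolutely continuous on
`[t₀, ∞)`, satisfies the equation for almost every `t ≥ t₀`, and agrees with `φ` on `(-∞, t₀]`. -/
structure IsSolution {m : ℕ} (a : ℝ → ℝ) (b h : Fin m → ℝ → ℝ) (R : Fin m → ℝ → ℝ → ℝ)
    (t₀ : ℝ) (φ : Iic t₀ →ᵇ ℝ) (x : ℝ → ℝ) : Prop where
  initial : ∀ s : Iic t₀, x s = φ s
  absolutelyContinuous : ∀ T, t₀ ≤ T → AbsolutelyContinuousOnInterval x t₀ T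
  equation : ∀ᵐ t ∂(volume.restrict (Ici t₀)), ∃ x' : ℝ, HasDerivAt x x' t ∧
    x' + a t * x t
      + ∑ k, b k t * ∫ s in Icc (h k t) t, x s ∂(stieltjesMeasure (R k t)) = 0

/-- Exponential stability: there are `M, α > 0` such that, for every initial point `t₀ ≥ 0` and
every bounded continuous initial function `φ` on `(-∞, t₀]`, each solution satisfies
`|x(t)| ≤ M ‖φ‖ exp (-α (t - t₀))` for `t ≥ t₀`, where `‖φ‖` is the sup-norm. -/
def ExponentiallyStable {m : ℕ} (a : ℝ → ℝ) (b h : Fin m → ℝ → ℝ)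
    (R : Fin m → ℝ → ℝ → ℝ) : Prop :=
  ∃ M > 0, ∃ α > 0, ∀ t₀ ≥ 0, ∀ (φ : Iic t₀ →ᵇ ℝ) (x : ℝ → ℝ),
    IsSolution a b h R t₀ φ x →
      ∀ t ≥ t₀, |x t| ≤ M * ‖φ‖ * Real.exp (-α * (t - t₀))

end

/-! Measured by the clock `A = ∫ a`, the delayed term is at most about `β` times the supremum of
`|x|` over a window of length about `h₀`. The weighted function `z = exp (ε A) x`, on the clock `(1
- ε) A`, obeys one-sided inequalities of the same kind for `z` and `-z` (`IsSolution.yorkeUpper`),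
with constants `β'`, `h'` that still satisfy the strict condition for small `ε`
(`exists_perturbed_yorke_condition`).

It then suffices that `|z|` never exceeds its maximum over an initial stretch
(`abs_le_of_yorkeUpper`). A new extremum `K` must follow a zero of `z` by at most `h'` units of the
clock. Climbing from that zero to `K` in so short a time contradicts the condition
(`YorkeUpper.lt_of_bound`).

The initial stretch has a length independent of `t₀`, and `IsSolution.abs_le_exp` controls `x`
there. Boundedness of `exp (ε A) x` is exponential decay of `x`, because `a ≥ a₀`. -/

theorem AbsolutelyContinuousOnInterval.le_of_ae_deriv_nonpos {f : ℝ → ℝ} {s t : ℝ} (hst : s ≤ t)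
    (hf : AbsolutelyContinuousOnInterval f s t)
    (h : ∀ᵐ u, u ∈ Icc s t → ∃ f' : ℝ, HasDerivAt f f' u ∧ f' ≤ 0) : f t ≤ f s := by
  have h1 := hf.integral_deriv_eq_sub
  have h2 : ∫ u in s..t, deriv f u ≤ 0 := by
    rw [intervalIntegral.integral_of_le hst]
    apply integral_nonpos_of_ae
    rw [EventuallyLE, ae_restrict_iff' measurableSet_Ioc]
    filter_upwards [h] with u hu hm
    obtain ⟨f', h3, h4⟩ := hu ⟨hm.1.le, hm.2⟩
    simpa [h3.deriv] using h4
  linarith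

/-! ### Time scales and differential inequalities -/

/-- `P` is a Lipschitz, strictly increasing primitive of the positive function `p` on `[0, ∞)`. -/
structure IsClock (P p : ℝ → ℝ) : Prop where
  lipschitz : ∃ C, LipschitzOnWith C P (Ici 0)
  strictMono : StrictMonoOn P (Ici 0)
  hasDerivAt : ∀ᵐ t, 0 ≤ t → HasDerivAt P (p t) t
  pos : ∀ t, 0 ≤ t → 0 < p t

namespace IsClock

variable {P p : ℝ → ℝ}

theorem le (hP : IsClock P p) {s t : ℝ} (hs : 0 ≤ s) (hst : s ≤ t) : P s ≤ P t :=
  hP.strictMono.monotoneOn hs (hs.trans hst) hst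

theorem lt_of_lt (hP : IsClock P p) {s t : ℝ} (hs : 0 ≤ s) (ht : 0 ≤ t) (h : P s < P t) : s < t :=
  (hP.strictMono.lt_iff_lt hs ht).1 h

theorem absolutelyContinuous (hP : IsClock P p) {s t : ℝ} (hs : 0 ≤ s) (hst : s ≤ t) :
    AbsolutelyContinuousOnInterval P s t := by
  obtain ⟨C, hC⟩ := hP.lipschitz
  refine (hC.mono ?_).absolutelyContinuousOnInterval
  rw [uIcc_of_le hst]
  exact fun u hu => hs.trans hu.1

theorem absolutelyContinuous_exp_mul (hP : IsClock P p) (r : ℝ) {s t : ℝ} (hs : 0 ≤ s)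
    (hst : s ≤ t) : AbsolutelyContinuousOnInterval (fun u => Real.exp (r * P u)) s t := by
  obtain ⟨C, hC⟩ := hP.lipschitz
  obtain ⟨K, hK⟩ := ContDiffOn.exists_lipschitzOnWith
    (f := fun y : ℝ => Real.exp (r * y)) (s := Icc (P s) (P t))
    ((by fun_prop : ContDiff ℝ 1 fun y : ℝ => Real.exp (r * y)).contDiffOn) one_ne_zero (convex_Icc _ _) isCompact_Icc
  refine (hK.comp (hC.mono (?_ : uIcc s t ⊆ Ici 0)) ?_).absolutelyContinuousOnInterval
  · rw [uIcc_of_le hst]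
    exact fun u hu => hs.trans hu.1
  · rw [uIcc_of_le hst]
    exact fun u hu => ⟨hP.le hs hu.1, hP.le (hs.trans hu.1) hu.2⟩

theorem exists_eq (hP : IsClock P p) {s t y : ℝ} (hs : 0 ≤ s) (hst : s ≤ t) (h1 : P s ≤ y)
    (h2 : y ≤ P t) : ∃ v, s ≤ v ∧ v ≤ t ∧ P v = y := by
  have hc := (hP.absolutelyContinuous hs hst).continuousOn
  rw [uIcc_of_le hst] at hc
  obtain ⟨v, hv, rfl⟩ := intermediate_value_Icc hst hc ⟨h1, h2⟩
  exact ⟨v, hv.1, hv.2, rfl⟩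

/-- Variation of constants for the differential inequality `z' ≤ p (c₀ + c₁ exp (-P) - z)`. -/
theorem exp_mul_sub_le (hP : IsClock P p) {z : ℝ → ℝ} {s t c₀ c₁ : ℝ} (hs : 0 ≤ s) (hst : s ≤ t)
    (hz : AbsolutelyContinuousOnInterval z s t)
    (h : ∀ᵐ u, u ∈ Ioo s t → ∃ z' : ℝ, HasDerivAt z z' u ∧
      z' ≤ p u * (c₀ + c₁ * Real.exp (-P u) - z u)) :
    Real.exp (P t) * z t - Real.exp (P s) * z s
      ≤ c₀ * (Real.exp (P t) - Real.exp (P s)) + c₁ * (P t - P s) := by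
  have hE : AbsolutelyContinuousOnInterval (fun u => Real.exp (P u)) s t := by
    simpa using hP.absolutelyContinuous_exp_mul 1 hs hst
  -- The subtracted terms are the exact primitive of the forcing after multiplication by `exp P`, so
  -- the difference has nonpositive derivative.
  have hac : AbsolutelyContinuousOnInterval
      (fun u => Real.exp (P u) * z u - c₀ * Real.exp (P u) - c₁ * P u) s t :=
    ((hE.mul hz).sub (hE.const_mul c₀)).sub ((hP.absolutelyContinuous hs hst).const_mul c₁)
  have key := AbsolutelyContinuousOnInterval.le_of_ae_deriv_nonpos hst hac (by
    filter_upwards [h, hP.hasDerivAt, Measure.ae_ne volume s, Measure.ae_ne volume t]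
      with u hu hPu hus hut hmem
    have hu0 := hs.trans hmem.1
    obtain ⟨z', hz', hle⟩ := hu ⟨lt_of_le_of_ne hmem.1 hus.symm, lt_of_le_of_ne hmem.2 hut⟩
    have hPd := hPu hu0
    refine ⟨_, ((hPd.exp.mul hz').sub (hPd.exp.const_mul c₀)).sub (hPd.const_mul c₁), ?_⟩
    have he : Real.exp (P u) * Real.exp (-P u) = 1 := by
      rw [← Real.exp_add]; simp
    have := mul_le_mul_of_nonneg_left hle (Real.exp_pos (P u)).le
    have h3 : Real.exp (P u) * (p u * (c₀ + c₁ * Real.exp (-P u) - z u))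
        = p u * (c₀ * Real.exp (P u) + c₁ * (Real.exp (P u) * Real.exp (-P u))
          - Real.exp (P u) * z u) := by ring
    rw [h3, he] at this
    linarith)
  linarith

end IsClock

/-! ### The Yorke argument -/

/-- On `[t₁, ∞)`, the function `z` satisfies the upper Yorke condition
`z' ≤ p (β · sup (-z)⁺ - z)`, the supremum being taken over the window `{u ≤ t | P t - h ≤ P u}`. -/
def YorkeUpper (P p : ℝ → ℝ) (β h t₁ : ℝ) (z : ℝ → ℝ) : Prop :=
  ∀ᵐ t, t₁ ≤ t → ∃ z' : ℝ, HasDerivAt z z' t ∧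
    ∀ c, 0 ≤ c → (∀ u, 0 ≤ u → u ≤ t → P t - h ≤ P u → -c ≤ z u) → z' ≤ p t * (β * c - z t)

/-- With `q = (β² + β) / (β² + 1)`, the tangent line of `exp` at `log q` gives `exp r ≥ q (1 + r -
log q)`, and the condition bounds `log q`. -/
theorem exp_mul_lt_of_yorke_condition {β h r : ℝ} (hβ : 0 < β)
    (hcond : Real.log ((β ^ 2 + β) / (β ^ 2 + 1)) < 1 / β * Real.exp (-h)) :
    (β ^ 2 + β) * (1 + r - 1 / β * Real.exp (-h)) < (β ^ 2 + 1) * Real.exp r := by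
  have hq : 0 < (β ^ 2 + β) / (β ^ 2 + 1) := by positivity
  have h1 := Real.add_one_le_exp (r - Real.log ((β ^ 2 + β) / (β ^ 2 + 1)))
  rw [Real.exp_sub, Real.exp_log hq, le_div_iff₀ hq] at h1
  have h2 : (1 + r - 1 / β * Real.exp (-h)) * ((β ^ 2 + β) / (β ^ 2 + 1)) < Real.exp r :=
    lt_of_lt_of_le (mul_lt_mul_of_pos_right (by linarith) hq) h1
  rw [mul_div_assoc', div_lt_iff₀ (by positivity)] at h2
  linarith

/-- Suppose `z T = K` and let `v` be the last zero before `T`. Integrating backwards from `v` bounds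
`z` below by `-β K (exp (P v - P u) - 1)`. After `v` the delayed term is therefore at most the
smaller of `β K` and `β² K (exp (P v + h - P s) - 1)`. Using the first bound until the two agree and
the second afterwards keeps `z T` below `K`. -/
theorem YorkeUpper.lt_of_bound {P p z : ℝ → ℝ} {β h t₁ T K : ℝ} (hP : IsClock P p)
    (hβ : 0 < β) (hh0 : 0 ≤ h) (hh : 1 + 1 / β ≤ Real.exp h)
    (hcond : Real.log ((β ^ 2 + β) / (β ^ 2 + 1)) < 1 / β * Real.exp (-h))
    (ht₁ : 0 ≤ t₁) (hz : ∀ s t, t₁ ≤ s → s ≤ t → AbsolutelyContinuousOnInterval z s t)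
    (hY : YorkeUpper P p β h t₁ z) (hK : 0 < K) (hT : t₁ ≤ T) (hPT : P t₁ + 2 * h < P T)
    (hlow : ∀ u, 0 ≤ u → u ≤ T → -K ≤ z u) (hup : ∀ u, 0 ≤ u → u ≤ T → z u ≤ K) : z T < K := by
  by_contra! hTK
  obtain ⟨t₂, h12, h2T, hPt₂⟩ := hP.exists_eq (y := P t₁ + h) ht₁ hT (by linarith) (by linarith)
  have ht₂ : 0 ≤ t₂ := ht₁.trans h12
  have hzc : ContinuousOn z (Icc t₁ T) := by
    simpa [uIcc_of_le hT] using (hz t₁ T le_rfl hT).continuousOn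
  -- the last zero of `z` before `T`
  obtain ⟨v, hv2, hvT, hv, hvpos⟩ : ∃ v, t₂ ≤ v ∧ v ≤ T ∧ (v = t₂ ∨ z v ≤ 0) ∧
      ∀ u, v < u → u ≤ T → 0 < z u := by
    -- Adjoining `t₂` makes the set nonempty; the case `v = t₂` is excluded once `P T ≤ P v + h` is
    -- known.
    have hcomp : IsCompact ({t₂} ∪ (Icc t₂ T ∩ z ⁻¹' Iic 0)) := by
      refine isCompact_singleton.union ?_
      refine isCompact_Icc.of_isClosed_subset ?_ inter_subset_left
      exact (hzc.mono (Icc_subset_Icc_left h12)).preimage_isClosed_of_isClosed isClosed_Icc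
        isClosed_Iic
    obtain ⟨v, hv, hmax⟩ := hcomp.exists_isGreatest ⟨t₂, Or.inl rfl⟩
    have hv' : t₂ ≤ v ∧ v ≤ T := by
      rcases hv with hv | hv
      · rw [mem_singleton_iff.1 hv]; exact ⟨le_rfl, h2T⟩
      · exact hv.1
    refine ⟨v, hv'.1, hv'.2, hv.imp id (fun h => h.2), fun u hu huT => ?_⟩
    by_contra! hcon
    exact absurd (hmax (Or.inr ⟨⟨hv'.1.trans hu.le, huT⟩, hcon⟩)) (not_le.2 hu)
  have hv0 : 0 ≤ v := ht₂.trans hv2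
  have h1v : t₁ ≤ v := h12.trans hv2
  have hPv : P t₁ + h ≤ P v := hPt₂ ▸ hP.le ht₂ hv2
  -- If `T` is more than `h` past `v`, then from `w` on the windows see only positive values, so `z'
  -- ≤ -p z` and `z w > K`.
  rcases lt_or_ge (P v + h) (P T) with hlt | hge
  · obtain ⟨w, hvw, hwT, hPw⟩ := hP.exists_eq (y := P v + h) hv0 hvT (by linarith) hlt.le
    have hw0 := hv0.trans hvw
    have := hP.exp_mul_sub_le (c₀ := 0) (c₁ := 0) hw0 hwT (hz w T (h1v.trans hvw) hwT) (by
      filter_upwards [hY] with s hs hmem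
      obtain ⟨z', hz', hle⟩ := hs (h1v.trans (hvw.trans hmem.1.le))
      have hs0 := hw0.trans hmem.1.le
      refine ⟨z', hz', (hle 0 le_rfl fun u hu0 hus hPu => ?_).trans_eq (by ring)⟩
      have hPs : P w < P s := hP.strictMono hw0 hs0 hmem.1
      have := hvpos u (hP.lt_of_lt hv0 hu0 (by linarith)) (hus.trans hmem.2.le)
      linarith)
    have hPwT : Real.exp (P w) < Real.exp (P T) := Real.exp_lt_exp.2 (by linarith)
    have h1 := mul_le_mul_of_nonneg_left hTK (Real.exp_pos (P T)).le
    have h2 := mul_le_mul_of_nonneg_left (hup w hw0 hwT) (Real.exp_pos (P w)).le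
    nlinarith
  have hzv_le : z v ≤ 0 := by
    rcases hv with rfl | hv
    · linarith
    · exact hv
  have hvT' : v < T := by
    refine lt_of_le_of_ne hvT fun h => ?_
    rw [h] at hzv_le; linarith
  have hzv_ge : 0 ≤ z v := by
    have hcv : ContinuousWithinAt z (Ioc v T) v :=
      (hzc v ⟨h1v, hvT⟩).mono fun u hu => ⟨h1v.trans hu.1.le, hu.2⟩
    have : (𝓝[Ioc v T] v).NeBot := by
      rw [nhdsWithin_Ioc_eq_nhdsGT hvT']; infer_instance
    exact ge_of_tendsto hcv (eventually_nhdsWithin_of_forall fun u hu => (hvpos u hu.1 hu.2).le)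
  have hzv : z v = 0 := le_antisymm hzv_le hzv_ge
  -- `z` from below before `v`
  have hback : ∀ u, t₁ ≤ u → u ≤ v → -(β * K * (Real.exp (P v - P u) - 1)) ≤ z u := by
    intro u hu huv
    have hu0 := ht₁.trans hu
    have := hP.exp_mul_sub_le (c₀ := β * K) (c₁ := 0) hu0 huv (hz u v hu huv) (by
      filter_upwards [hY] with s hs hmem
      obtain ⟨z', hz', hle⟩ := hs (hu.trans hmem.1.le)
      refine ⟨z', hz', (hle K hK.le fun w hw0 hws _ => ?_).trans_eq (by ring)⟩
      exact hlow w hw0 (hws.trans (hmem.2.le.trans hvT)))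
    rw [hzv] at this
    have he : Real.exp (P v) = Real.exp (P u) * Real.exp (P v - P u) := by
      rw [← Real.exp_add]; ring_nf
    rw [he] at this
    have hpos := Real.exp_pos (P u)
    refine le_of_mul_le_mul_left ?_ hpos
    linarith
  have hwin : ∀ s, v ≤ s → s ≤ T → ∀ u, 0 ≤ u → u ≤ s → P s - h ≤ P u →
      -(β * K * (Real.exp (P v + h - P s) - 1)) ≤ z u := by
    intro s hvs hsT u hu0 hus hPu
    have hPvs : P v ≤ P s := hP.le hv0 hvs
    have hPsT : P s ≤ P T := hP.le (hv0.trans hvs) hsT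
    have hβK : 0 < β * K := by positivity
    rcases le_or_gt u v with huv | huv
    · have h1u : t₁ ≤ u := by
        by_contra! hcon
        have := hP.strictMono hu0 ht₁ hcon
        linarith
      have := hback u h1u huv
      have h3 : Real.exp (P v - P u) ≤ Real.exp (P v + h - P s) := Real.exp_le_exp.2 (by linarith)
      nlinarith
    · have h1 := hvpos u huv (hus.trans hsT)
      have h2 : 1 ≤ Real.exp (P v + h - P s) := Real.one_le_exp (by linarith)
      nlinarith
  have stage1 : ∀ w, v ≤ w → w ≤ T → Real.exp (P w) * z w
      ≤ β * K * (Real.exp (P w) - Real.exp (P v)) := by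
    intro w hvw hwT
    have := hP.exp_mul_sub_le (c₀ := β * K) (c₁ := 0) hv0 hvw (hz v w h1v hvw) (by
      filter_upwards [hY] with s hs hmem
      obtain ⟨z', hz', hle⟩ := hs (h1v.trans hmem.1.le)
      refine ⟨z', hz', (hle K hK.le fun u hu0 hus _ => ?_).trans_eq (by ring)⟩
      exact hlow u hu0 (hus.trans (hmem.2.le.trans hwT)))
    rw [hzv] at this
    linarith
  -- the instant at which the two bounds for the delayed term agree
  have hβ1 : 0 < 1 + 1 / β := by positivity
  set l := Real.log (1 + 1 / β) with hl
  have hlh : l ≤ h := (Real.log_le_iff_le_exp hβ1).2 hh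
  have hel : Real.exp l = 1 + 1 / β := Real.exp_log hβ1
  have hratio : Real.exp (-(h - l)) = (1 + β) * (1 / β * Real.exp (-h)) := by
    rw [neg_sub, Real.exp_sub, hel, Real.exp_neg]
    field_simp
    ring
  set ρ := 1 / β * Real.exp (-h) with hρ
  have hββ : 0 < β ^ 2 := by positivity
  rcases le_or_gt (P T) (P v + (h - l)) with hcase | hcase
  · have h1 := stage1 T hvT le_rfl
    have h2 : Real.exp (-(h - l)) * Real.exp (P T) ≤ Real.exp (P v) := by
      rw [← Real.exp_add]; exact Real.exp_le_exp.2 (by linarith)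
    rw [hratio] at h2
    have h3 := exp_mul_lt_of_yorke_condition (r := 0) hβ hcond
    rw [Real.exp_zero, ← hρ] at h3
    have hET := Real.exp_pos (P T)
    have h4 : Real.exp (P T) * K ≤ β * K * (Real.exp (P T) - (1 + β) * ρ * Real.exp (P T)) := by
      have := mul_le_mul_of_nonneg_left hTK hET.le
      have := mul_le_mul_of_nonneg_left h2 (mul_pos hβ hK).le
      linarith
    have h5 : Real.exp (P T) * K * 1 ≤ Real.exp (P T) * K * (β - β * (1 + β) * ρ) := by linarith
    have h6 := le_of_mul_le_mul_left h5 (by positivity)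
    nlinarith
  · obtain ⟨w, hvw, hwT, hPw⟩ := hP.exists_eq (y := P v + (h - l)) hv0 hvT (by linarith) hcase.le
    have hw0 := hv0.trans hvw
    have h1 := stage1 w hvw hwT
    have h2 := hP.exp_mul_sub_le (c₀ := -(β ^ 2 * K))
      (c₁ := β ^ 2 * K * Real.exp (P v + h)) hw0 hwT (hz w T (h1v.trans hvw) hwT) (by
      filter_upwards [hY] with s hs hmem
      have hvs := hvw.trans hmem.1.le
      obtain ⟨z', hz', hle⟩ := hs (h1v.trans hvs)
      have hPs : P s ≤ P T := hP.le (hv0.trans hvs) hmem.2.le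
      have he1 : 1 ≤ Real.exp (P v + h - P s) := Real.one_le_exp (by linarith)
      refine ⟨z', hz', (hle (β * K * (Real.exp (P v + h - P s) - 1))
        (mul_nonneg (by positivity) (by linarith)) (hwin s hvs hmem.2.le)).trans_eq ?_⟩
      rw [sub_eq_add_neg (P v + h), Real.exp_add (P v + h)]
      ring)
    have hEw := Real.exp_pos (P w)
    set r := P T - P w with hr
    have e1 : Real.exp (P T) = Real.exp (P w) * Real.exp r := by
      rw [← Real.exp_add, hr]; ring_nf
    have e2 : Real.exp (P v) = Real.exp (P w) * ((1 + β) * ρ) := by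
      rw [← hratio, ← Real.exp_add, hPw]; ring_nf
    have e3 : Real.exp (P v + h) = Real.exp (P w) * (1 + 1 / β) := by
      rw [← hel, ← Real.exp_add, hPw]; ring_nf
    rw [e2] at h1
    rw [e1, e3] at h2
    have h3 := exp_mul_lt_of_yorke_condition (r := r) hβ hcond
    rw [← hρ] at h3
    have h4 := mul_le_mul_of_nonneg_left hTK (mul_pos hEw (Real.exp_pos r)).le
    have h5 : Real.exp (P w) * K * Real.exp r ≤ Real.exp (P w) * K *
        (β - β * (1 + β) * ρ + β ^ 2 * ((1 + 1 / β) * r - Real.exp r + 1)) := by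
      linarith
    have h6 := le_of_mul_le_mul_left h5 (by positivity)
    have h7 : β ^ 2 * ((1 + 1 / β) * r) = (β ^ 2 + β) * r := by
      field_simp
    have h8 : β ^ 2 * ((1 + 1 / β) * r - Real.exp r + 1)
        = (β ^ 2 + β) * r - β ^ 2 * Real.exp r + β ^ 2 := by rw [← h7]; ring
    rw [h8] at h6
    linarith

/-- A maximum point of `|z|` above `N` lies past `t₂`, where `YorkeUpper.lt_of_bound` for `z` or for
`-z` forbids it. -/
theorem abs_le_of_yorkeUpper {P p z : ℝ → ℝ} {β h t₁ t₂ N : ℝ} (hP : IsClock P p)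
    (hβ : 0 < β) (hh0 : 0 ≤ h) (hh : 1 + 1 / β ≤ Real.exp h)
    (hcond : Real.log ((β ^ 2 + β) / (β ^ 2 + 1)) < 1 / β * Real.exp (-h))
    (ht₁ : 0 ≤ t₁) (hz : ∀ s t, t₁ ≤ s → s ≤ t → AbsolutelyContinuousOnInterval z s t)
    (hzc : ContinuousOn z (Ici 0))
    (hY : YorkeUpper P p β h t₁ z) (hY' : YorkeUpper P p β h t₁ (-z))
    (h12 : t₁ ≤ t₂) (hPt : P t₁ + 2 * h ≤ P t₂) (hN : 0 ≤ N)
    (hbd : ∀ u, 0 ≤ u → u ≤ t₂ → |z u| ≤ N) {t : ℝ} (ht : 0 ≤ t) : |z t| ≤ N := by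
  by_contra! hcon
  obtain ⟨T, hT, hmax⟩ := isCompact_Icc.exists_isMaxOn (nonempty_Icc.2 ht)
    (hzc.mono Icc_subset_Ici_self).abs
  have hK : N < |z T| := hcon.trans_le (hmax ⟨ht, le_rfl⟩)
  have h2T : t₂ < T := by
    by_contra! hle
    exact absurd (hbd T hT.1 hle) (not_le.2 hK)
  have hb : ∀ u, 0 ≤ u → u ≤ T → |z u| ≤ |z T| := fun u h1 h2 => hmax ⟨h1, h2.trans hT.2⟩
  have hPT : P t₁ + 2 * h < P T := hPt.trans_lt (hP.strictMono (ht₁.trans h12) hT.1 h2T)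
  have hpos : 0 < |z T| := hN.trans_lt hK
  rcases le_total 0 (z T) with hs | hs
  · have := hY.lt_of_bound hP hβ hh0 hh hcond ht₁ hz hpos (h12.trans h2T.le) hPT
      (fun u h1 h2 => (abs_le.1 (hb u h1 h2)).1) (fun u h1 h2 => (abs_le.1 (hb u h1 h2)).2)
    rw [abs_of_nonneg hs] at this
    exact lt_irrefl _ this
  · have := hY'.lt_of_bound hP hβ hh0 hh hcond ht₁ (fun s t h1 h2 => (hz s t h1 h2).neg) hpos
      (h12.trans h2T.le) hPT
      (fun u h1 h2 => neg_le_neg (abs_le.1 (hb u h1 h2)).2)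
      (fun u h1 h2 => neg_le.1 (abs_le.1 (hb u h1 h2)).1)
    rw [abs_of_nonpos hs] at this
    exact lt_irrefl _ this

/-! ### Choice of the constants -/

/-- At `β = 1` the logarithm vanishes, so values `β ≤ 1`, including `0`, can be raised to `1` at no
cost. -/
theorem yorke_condition_max_one {β h : ℝ}
    (hcond : β = 0 ∨ 1 / β * Real.exp (-h) > Real.log ((β ^ 2 + β) / (β ^ 2 + 1))) :
    Real.log ((max β 1 ^ 2 + max β 1) / (max β 1 ^ 2 + 1)) < 1 / max β 1 * Real.exp (-h) := by
  rcases le_or_gt β 1 with h1 | h1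
  · rw [max_eq_right h1]
    norm_num
    exact Real.exp_pos _
  · rw [max_eq_left h1.le]
    exact hcond.resolve_left (by linarith)

/-- For this `h` the right side is `1 / (β + 1)`, while `log q ≤ q - 1 = (β - 1) / (β² + 1)`. -/
theorem yorke_condition_log {β : ℝ} (hβ : 0 < β) :
    Real.log ((β ^ 2 + β) / (β ^ 2 + 1)) < 1 / β * Real.exp (-Real.log (1 + 1 / β)) := by
  have h1 := Real.log_le_sub_one_of_pos (show 0 < (β ^ 2 + β) / (β ^ 2 + 1) by positivity)
  have h2 : 1 / β * Real.exp (-Real.log (1 + 1 / β)) = 1 / (β + 1) := by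
    rw [Real.exp_neg, Real.exp_log (by positivity)]
    field_simp
  rw [h2]
  refine h1.trans_lt ?_
  rw [div_sub_one (by positivity), div_lt_div_iff₀ (by positivity) (by positivity)]
  nlinarith

/-- The stability condition is stable under small perturbations of the constants. -/
theorem exists_perturbed_yorke_condition {β h₀ : ℝ}
    (hcond : β = 0 ∨ 1 / β * Real.exp (-h₀) > Real.log ((β ^ 2 + β) / (β ^ 2 + 1))) :
    ∃ ε b' h' β' : ℝ, 0 < ε ∧ ε < 1 ∧ β < b' ∧ 0 < b' ∧ h₀ < h' ∧ 0 ≤ h' ∧ 0 < β' ∧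
      β' * (1 - ε) = b' * Real.exp (ε * h') ∧ 1 + 1 / β' ≤ Real.exp h' ∧
      Real.log ((β' ^ 2 + β') / (β' ^ 2 + 1)) < 1 / β' * Real.exp (-h') := by
  set B := max β 1 with hB
  have hB0 : 0 < B := lt_of_lt_of_le one_pos (le_max_right _ _)
  -- Enlarging the delay to `log (1 + 1 / B)` ensures that the two bounds in
  -- `YorkeUpper.lt_of_bound` cross no earlier than `v`.
  set H := max h₀ (Real.log (1 + 1 / B)) with hH
  have hBH : Real.log ((B ^ 2 + B) / (B ^ 2 + 1)) < 1 / B * Real.exp (-H) := by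
    rcases max_choice h₀ (Real.log (1 + 1 / B)) with h | h
    · rw [hH, h]; exact yorke_condition_max_one hcond
    · rw [hH, h]; exact yorke_condition_log hB0
  have hH0 : 0 ≤ H := le_trans (Real.log_nonneg (by
    have : 0 < 1 / B := by positivity
    linarith)) (le_max_right _ _)
  -- The perturbed `β'`: the exponential is the growth of the weight across one window, and `1 - ε`
  -- is the slowing of the clock.
  set g : ℝ → ℝ := fun ε => (B + ε) * Real.exp (ε * (H + ε)) / (1 - ε) with hg
  have g0 : g 0 = B := by simp [hg]
  have hgc : ContinuousAt g 0 := by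
    refine ContinuousAt.div (by fun_prop) (by fun_prop) (by norm_num)
  have hev : ∀ᶠ ε in 𝓝 (0 : ℝ), Real.log ((g ε ^ 2 + g ε) / (g ε ^ 2 + 1))
      < 1 / g ε * Real.exp (-(H + ε)) := by
    refine ContinuousAt.eventually_lt ?_ ?_ (by simpa [g0] using hBH)
    · refine ContinuousAt.log (ContinuousAt.div (by fun_prop) (by fun_prop) (by positivity)) ?_
      rw [g0]; positivity
    · refine ContinuousAt.mul (ContinuousAt.div (by fun_prop) hgc (by rw [g0]; positivity)) ?_
      fun_prop
  obtain ⟨ε, ⟨hε, hε1⟩, hε0⟩ := (((hev.and (eventually_lt_nhds one_pos)).filter_mono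
    nhdsWithin_le_nhds).and (self_mem_nhdsWithin : Ioi (0 : ℝ) ∈ 𝓝[>] 0)).exists
  have hε0 : 0 < ε := hε0
  have hgB : B ≤ g ε := by
    rw [hg]
    simp only
    rw [le_div_iff₀ (by linarith)]
    have : 1 ≤ Real.exp (ε * (H + ε)) := Real.one_le_exp (by positivity)
    nlinarith
  refine ⟨ε, B + ε, H + ε, g ε, hε0, hε1, ?_, by linarith, ?_, by linarith, by linarith, ?_, ?_, hε⟩
  · linarith [le_max_left β 1]
  · linarith [le_max_left h₀ (Real.log (1 + 1 / B))]
  · rw [hg]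
    simp only
    rw [div_mul_cancel₀]
    linarith
  · calc 1 + 1 / g ε ≤ 1 + 1 / B := by gcongr
      _ = Real.exp (Real.log (1 + 1 / B)) := (Real.exp_log (by positivity)).symm
      _ ≤ Real.exp (H + ε) := Real.exp_le_exp.2
        (by linarith [le_max_right h₀ (Real.log (1 + 1 / B))])

/-! ### The clock of the coefficient `a`, and averages over the delay -/

theorem MeasureTheory.MemLp.exists_ae_abs_le {f : ℝ → ℝ}
    (hf : MemLp f ⊤ (volume.restrict (Ici 0))) :
    ∃ C, 0 ≤ C ∧ ∀ᵐ t, 0 ≤ t → |f t| ≤ C := by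
  refine ⟨(eLpNorm f ⊤ (volume.restrict (Ici 0))).toReal, ENNReal.toReal_nonneg, ?_⟩
  have h := ae_le_eLpNormEssSup (f := f) (μ := volume.restrict (Ici 0))
  rw [ae_restrict_iff' measurableSet_Ici] at h
  filter_upwards [h] with t ht h0
  have := ENNReal.toReal_mono hf.2.ne ((ht h0).trans_eq eLpNorm_exponent_top.symm)
  simpa using this

/-- The primitive vanishing at `0` of a bounded function bounded below by a positive constant. -/
theorem exists_isClock {a : ℝ → ℝ} (ha : MemLp a ⊤ (volume.restrict (Ici 0))) {a₀ : ℝ}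
    (ha₀ : 0 < a₀) (ha_ge : ∀ t, 0 ≤ t → a₀ ≤ a t) :
    ∃ A : ℝ → ℝ, IsClock A a ∧ (∀ s t, 0 ≤ s → s ≤ t → a₀ * (t - s) ≤ A t - A s) ∧
      ∀ s t, 0 ≤ s → s ≤ t → ∫ u in s..t, a u = A t - A s := by
  obtain ⟨C, hC0, hC⟩ := ha.exists_ae_abs_le
  -- Nothing is known of `a` on the negative axis; the cutoff is locally integrable on the whole
  -- line.
  set f := (Ici (0 : ℝ)).indicator a with hf
  have hfL : MemLp f ⊤ volume := (memLp_indicator_iff_restrict measurableSet_Ici).2 ha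
  have hloc : LocallyIntegrable f volume := hfL.locallyIntegrable le_top
  have hint : ∀ s t, IntervalIntegrable f volume s t := fun s t =>
    (hloc.integrableOn_isCompact isCompact_uIcc).intervalIntegrable
  have hfC : ∀ᵐ t, ‖f t‖ ≤ C := by
    filter_upwards [hC] with t ht
    by_cases h0 : 0 ≤ t
    · simpa [hf, h0] using ht h0
    · simpa [hf, h0] using hC0
  have hsub : ∀ s t, (∫ u in 0..t, f u) - ∫ u in 0..s, f u = ∫ u in s..t, f u := fun s t =>
    intervalIntegral.integral_interval_sub_left (hint _ _) (hint _ _)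
  have hlow : ∀ s t, 0 ≤ s → s ≤ t →
      a₀ * (t - s) ≤ (∫ u in 0..t, f u) - ∫ u in 0..s, f u := by
    intro s t hs hst
    rw [hsub]
    have := intervalIntegral.integral_mono_on (f := fun _ => a₀) hst (by simp) (hint s t)
      (fun u hu => by
        have h0 : 0 ≤ u := hs.trans hu.1
        simpa [hf, h0] using ha_ge u h0)
    simpa [mul_comm] using this
  refine ⟨fun t => ∫ u in 0..t, f u, ⟨⟨C.toNNReal, ?_⟩, ?_, ?_, ?_⟩, hlow, ?_⟩
  · refine LipschitzOnWith.of_dist_le_mul fun s _ t _ => ?_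
    rw [Real.dist_eq, hsub, Real.dist_eq, Real.coe_toNNReal _ hC0]
    exact intervalIntegral.norm_integral_le_of_norm_le_const_ae
      (hfC.mono fun u hu _ => hu)
  · intro s hs t _ hst
    have := hlow s t hs hst.le
    have : 0 < a₀ * (t - s) := mul_pos ha₀ (sub_pos.2 hst)
    simp only
    linarith
  · filter_upwards [LocallyIntegrable.ae_hasDerivAt_integral hloc] with t ht h0
    simpa [hf, h0] using ht 0
  · exact fun t ht => ha₀.trans_le (ha_ge t ht)
  · intro s t hs hst
    rw [hsub]
    refine intervalIntegral.integral_congr fun u hu => ?_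
    rw [uIcc_of_le hst] at hu
    have h0 : 0 ≤ u := hs.trans hu.1
    simp [hf, h0]

theorem IsClock.const_mul {P p : ℝ → ℝ} (hP : IsClock P p) {c : ℝ} (hc : 0 < c) :
    IsClock (fun t => c * P t) (fun t => c * p t) where
  lipschitz := by
    obtain ⟨C, hC⟩ := hP.lipschitz
    exact ⟨_, (lipschitzWith_smul c).comp_lipschitzOnWith hC⟩
  strictMono := fun s hs t ht hst =>
    mul_lt_mul_of_pos_left (hP.strictMono hs ht hst) hc
  hasDerivAt := hP.hasDerivAt.mono fun t ht h0 => (ht h0).const_mul c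
  pos := fun t ht => mul_pos hc (hP.pos t ht)

theorem neg_le_setIntegral_of_neg_le {ν : Measure ℝ} {s : Set ℝ} (hs : IsCompact s)
    (hν : ν s = 1) {x : ℝ → ℝ} (hx : Continuous x) {D : ℝ} (h : ∀ u ∈ s, -D ≤ x u) :
    -D ≤ ∫ u in s, x u ∂ν := by
  obtain ⟨C, hC⟩ := hs.exists_bound_of_continuousOn hx.continuousOn
  have hfin : ν s < ⊤ := by simp [hν]
  have hi : IntegrableOn x s ν := IntegrableOn.of_bound hfin
    hx.aestronglyMeasurable C ((ae_restrict_iff' hs.measurableSet).2 (ae_of_all _ hC))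
  have := setIntegral_mono_on (f := fun _ => -D) (integrableOn_const hfin.ne) hi hs.measurableSet h
  simpa [measureReal_def, hν] using this

theorem abs_setIntegral_le_of_abs_le {ν : Measure ℝ} {s : Set ℝ}
    (hν : ν s = 1) {x : ℝ → ℝ} {D : ℝ} (h : ∀ u ∈ s, |x u| ≤ D) :
    |∫ u in s, x u ∂ν| ≤ D := by
  have := norm_setIntegral_le_of_norm_le_const (μ := ν) (f := x) (by simp [hν]) h
  simpa [measureReal_def, hν, Real.norm_eq_abs] using this

/-! ### Properties of solutions -/

namespace IsSolution

variable {m : ℕ} {a : ℝ → ℝ} {b h : Fin m → ℝ → ℝ} {R : Fin m → ℝ → ℝ → ℝ} {t₀ : ℝ}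
  {φ : Iic t₀ →ᵇ ℝ} {x : ℝ → ℝ}

theorem neg (hx : IsSolution a b h R t₀ φ x) : IsSolution a b h R t₀ (-φ) (-x) where
  initial := fun s => by simp [hx.initial s]
  absolutelyContinuous := fun T hT => (hx.absolutelyContinuous T hT).neg
  equation := by
    filter_upwards [hx.equation] with t ⟨x', hx', heq⟩
    refine ⟨-x', hx'.neg, ?_⟩
    simp only [Pi.neg_apply, integral_neg, mul_neg, Finset.sum_neg_distrib]
    linarith

theorem continuous (hx : IsSolution a b h R t₀ φ x) : Continuous x := by
  have h1 : ContinuousOn x (Iic t₀) := by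
    rw [continuousOn_iff_continuous_domRestrict]
    convert φ.continuous using 1
    exact funext hx.initial
  have h2 : ContinuousOn x (Ici t₀) := by
    intro t ht
    have hc := (hx.absolutelyContinuous (t + 1) (by linarith [mem_Ici.1 ht])).continuousOn
    rw [uIcc_of_le (by linarith [mem_Ici.1 ht])] at hc
    refine (hc t ⟨ht, by linarith⟩).mono_of_mem_nhdsWithin ?_
    rw [← Ici_inter_Iic]
    exact inter_mem self_mem_nhdsWithin (mem_nhdsWithin_of_mem_nhds (Iic_mem_nhds (by linarith)))
  rw [← continuousOn_univ, ← Iic_union_Ici (a := t₀)]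
  exact h1.union_of_isClosed h2 isClosed_Iic isClosed_Ici

theorem abs_le_norm (hx : IsSolution a b h R t₀ φ x) {t : ℝ} (ht : t ≤ t₀) : |x t| ≤ ‖φ‖ := by
  have := φ.norm_coe_le_norm ⟨t, ht⟩
  rwa [← hx.initial] at this

/-- Excludes a first contact with the barrier `ψ`: before `T` the derivative of `x` is at most `(Ca
+ Cb) ψ = ψ'`, and `x` starts below `ψ`. -/
theorem lt_exp (hx : IsSolution a b h R t₀ φ x) (ht₀ : 0 ≤ t₀) {Ca Cb : ℝ}
    (hCa : ∀ᵐ t, 0 ≤ t → |a t| ≤ Ca) (hCb : ∀ᵐ t, 0 ≤ t → ∑ k, b k t ≤ Cb)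
    (hb_nonneg : ∀ k t, 0 ≤ t → 0 ≤ b k t)
    (hR_mass : ∀ k, ∀ᵐ t ∂(volume.restrict (Ici 0)),
      stieltjesMeasure (R k t) (Icc (h k t) t) = 1)
    {η T : ℝ} (hT : t₀ ≤ T) (hη : ‖φ‖ < η)
    (hbd : ∀ t, t₀ ≤ t → t < T → |x t| < η * Real.exp ((Ca + Cb) * (t - t₀))) (hC : 0 ≤ Ca + Cb) :
    x T < η * Real.exp ((Ca + Cb) * (T - t₀)) := by
  have hη0 : 0 < η := (norm_nonneg _).trans_lt hη
  set ψ : ℝ → ℝ := fun t => η * Real.exp ((Ca + Cb) * (t - t₀)) with hψ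
  have hψd : ∀ t, HasDerivAt ψ ((Ca + Cb) * ψ t) t := fun t => by
    have := (((hasDerivAt_id t).sub_const t₀).const_mul (Ca + Cb)).exp.const_mul η
    refine this.congr_deriv ?_
    simp only [hψ, id]
    ring
  have hψac : AbsolutelyContinuousOnInterval ψ t₀ T :=
    ContDiffOn.absolutelyContinuousOnInterval
      (by fun_prop : ContDiff ℝ 1 fun t => η * Real.exp ((Ca + Cb) * (t - t₀))).contDiffOn
  have hψmono : Monotone ψ := fun s t hst => by
    simp only [hψ]
    gcongr
  have hψ0 : ψ t₀ = η := by simp [hψ]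
  have key := AbsolutelyContinuousOnInterval.le_of_ae_deriv_nonpos hT
    ((hx.absolutelyContinuous T hT).sub hψac) (by
    have heq := hx.equation
    rw [ae_restrict_iff' measurableSet_Ici] at heq
    have hm := ae_all_iff.2 hR_mass
    rw [ae_restrict_iff' measurableSet_Ici] at hm
    filter_upwards [heq, hm, hCa, hCb, Measure.ae_ne volume T] with t het hmt hat hbt htT hmem
    have h0t : 0 ≤ t := ht₀.trans hmem.1
    obtain ⟨x', hx', he⟩ := het hmem.1
    refine ⟨_, hx'.sub (hψd t), ?_⟩
    have hxt : ∀ s, s ≤ t → |x s| ≤ ψ t := by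
      intro s hs
      rcases le_or_gt s t₀ with hs0 | hs0
      · exact (hx.abs_le_norm hs0).trans (hη.le.trans (hψ0 ▸ hψmono hmem.1))
      · exact (hbd s hs0.le (lt_of_le_of_lt hs (lt_of_le_of_ne hmem.2 htT))).le.trans (hψmono hs)
    have hψt : 0 ≤ ψ t := (abs_nonneg _).trans (hxt t le_rfl)
    have h1 : |a t * x t| ≤ Ca * ψ t := by
      rw [abs_mul]
      exact mul_le_mul (hat h0t) (hxt t le_rfl) (abs_nonneg _) ((abs_nonneg _).trans (hat h0t))
    have h2 : |∑ k, b k t * ∫ s in Icc (h k t) t, x s ∂(stieltjesMeasure (R k t))|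
        ≤ Cb * ψ t := by
      refine (Finset.abs_sum_le_sum_abs _ _).trans ?_
      refine le_trans (Finset.sum_le_sum (g := fun k => b k t * ψ t) fun k _ => ?_) ?_
      · rw [abs_mul, abs_of_nonneg (hb_nonneg k t h0t)]
        exact mul_le_mul_of_nonneg_left
          (abs_setIntegral_le_of_abs_le (hmt h0t k) fun s hs => hxt s hs.2) (hb_nonneg k t h0t)
      · rw [← Finset.sum_mul]
        exact mul_le_mul_of_nonneg_right (hbt h0t) hψt
    have h3 := neg_abs_le (a t * x t)
    have h4 := neg_abs_le (∑ k, b k t * ∫ s in Icc (h k t) t, x s ∂(stieltjesMeasure (R k t)))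
    linarith)
  have h5 := (le_abs_self _).trans (hx.abs_le_norm le_rfl)
  simp only [Pi.sub_apply] at key
  rw [hψ0] at key
  linarith

/-- A priori exponential growth bound for solutions. -/
theorem abs_le_exp (hx : IsSolution a b h R t₀ φ x) (ht₀ : 0 ≤ t₀) {Ca Cb : ℝ}
    (hCa : ∀ᵐ t, 0 ≤ t → |a t| ≤ Ca) (hCb : ∀ᵐ t, 0 ≤ t → ∑ k, b k t ≤ Cb)
    (hb_nonneg : ∀ k t, 0 ≤ t → 0 ≤ b k t)
    (hR_mass : ∀ k, ∀ᵐ t ∂(volume.restrict (Ici 0)),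
      stieltjesMeasure (R k t) (Icc (h k t) t) = 1)
    (hC : 0 ≤ Ca + Cb) {t : ℝ} (ht : t₀ ≤ t) :
    |x t| ≤ ‖φ‖ * Real.exp ((Ca + Cb) * (t - t₀)) := by
  have hstrict : ∀ η, ‖φ‖ < η → |x t| < η * Real.exp ((Ca + Cb) * (t - t₀)) := by
    intro η hη
    by_contra! hcon
    have hclosed : IsClosed {s | η * Real.exp ((Ca + Cb) * (s - t₀)) ≤ |x s|} :=
      isClosed_le (by fun_prop) hx.continuous.abs
    obtain ⟨T, ⟨hT, hTx⟩, hmin⟩ :=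
      (isCompact_Icc.inter_right hclosed).exists_isLeast ⟨t, ⟨ht, le_rfl⟩, hcon⟩
    have hbd : ∀ s, t₀ ≤ s → s < T → |x s| < η * Real.exp ((Ca + Cb) * (s - t₀)) := by
      intro s h1 h2
      by_contra! h3
      exact absurd (hmin ⟨⟨h1, h2.le.trans hT.2⟩, h3⟩) (not_le.2 h2)
    have h1 := hx.lt_exp ht₀ hCa hCb hb_nonneg hR_mass hT.1 hη hbd hC
    have h2 := hx.neg.lt_exp ht₀ hCa hCb hb_nonneg hR_mass hT.1 (by rwa [norm_neg])
      (fun s h1 h2 => by simpa using hbd s h1 h2) hC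
    exact absurd hTx (not_le.2 (abs_lt.2 ⟨by simp only [Pi.neg_apply] at h2; linarith, h1⟩))
  -- The strict bounds for all `η > ‖φ‖` give the bound with `‖φ‖` itself.
  have hE := Real.exp_pos ((Ca + Cb) * (t - t₀))
  rw [← div_le_iff₀ hE]
  refine le_of_forall_gt fun η hη => ?_
  rw [div_lt_iff₀ hE]
  exact hstrict η hη

/-- The exponentially weighted solution satisfies the upper Yorke condition. -/
theorem yorkeUpper (hx : IsSolution a b h R t₀ φ x) {A : ℝ → ℝ} (hA : IsClock A a)
    {ε b' h' β' T : ℝ} (hε0 : 0 < ε) (hε1 : ε < 1) (hβ' : β' * (1 - ε) = b' * Real.exp (ε * h'))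
    (hT : 0 ≤ T) (hb_nonneg : ∀ k t, 0 ≤ t → 0 ≤ b k t)
    (hR_mass : ∀ k, ∀ᵐ t ∂(volume.restrict (Ici 0)),
      stieltjesMeasure (R k t) (Icc (h k t) t) = 1)
    (hh : ∀ k t, T ≤ t → 0 ≤ h k t) (hAh : ∀ k t, T ≤ t → A t - A (h k t) ≤ h')
    (hb : ∀ t, T ≤ t → ∑ k, b k t ≤ b' * a t) :
    YorkeUpper (fun t => (1 - ε) * A t) (fun t => (1 - ε) * a t) β' h' (max t₀ T)
      (fun t => Real.exp (ε * A t) * x t) := by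
  have heq := hx.equation
  rw [ae_restrict_iff' measurableSet_Ici] at heq
  have hm := ae_all_iff.2 hR_mass
  rw [ae_restrict_iff' measurableSet_Ici] at hm
  filter_upwards [heq, hm, hA.hasDerivAt] with t het hmt hAt ht
  have hTt : T ≤ t := (le_max_right _ _).trans ht
  have h0t : 0 ≤ t := hT.trans hTt
  obtain ⟨x', hx', he⟩ := het ((le_max_left _ _).trans ht)
  refine ⟨_, ((hAt h0t).const_mul ε).exp.mul hx', fun c hc hwin => ?_⟩
  -- The lower bound `-c` for the weighted function, with the weight removed and moved from `s` to
  -- `t` at the cost of `exp (ε * h')`.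
  set D := c * Real.exp (ε * h') * Real.exp (-(ε * A t)) with hD
  have hD0 : 0 ≤ D := by positivity
  have hxs : ∀ k, ∀ s ∈ Icc (h k t) t, -D ≤ x s := by
    intro k s hs
    have hs0 := (hh k t hTt).trans hs.1
    have hAs : A t - A s ≤ h' := by
      have := hA.le (hh k t hTt) hs.1
      linarith [hAh k t hTt]
    have hAs0 : 0 ≤ A t - A s := sub_nonneg.2 (hA.le hs0 hs.2)
    -- A window of length `h'` for `A` is no longer than `h'` for the slower clock `(1 - ε) A`.
    have h1 := hwin s hs0 hs.2 (by nlinarith)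
    have h2 : -(c * Real.exp (-(ε * A s))) ≤ x s := by
      have h3 := mul_le_mul_of_nonneg_left h1 (Real.exp_pos (-(ε * A s))).le
      rw [← mul_assoc, ← Real.exp_add, neg_add_cancel, Real.exp_zero, one_mul] at h3
      linarith
    have h3 : c * Real.exp (-(ε * A s)) ≤ D := by
      rw [hD, mul_assoc, ← Real.exp_add]
      exact mul_le_mul_of_nonneg_left (Real.exp_le_exp.2 (by nlinarith)) hc
    linarith
  have hsum : -(b' * a t * D)
      ≤ ∑ k, b k t * ∫ s in Icc (h k t) t, x s ∂(stieltjesMeasure (R k t)) := by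
    calc -(b' * a t * D) ≤ ∑ k, b k t * -D := by
          rw [← Finset.sum_mul]
          nlinarith [hb t hTt]
      _ ≤ _ := Finset.sum_le_sum fun k _ => mul_le_mul_of_nonneg_left
          (neg_le_setIntegral_of_neg_le isCompact_Icc (hmt h0t k) hx.continuous (hxs k))
          (hb_nonneg k t h0t)
  have hED : Real.exp (ε * A t) * D = c * Real.exp (ε * h') := by
    rw [hD, mul_comm, mul_assoc, ← Real.exp_add, neg_add_cancel, Real.exp_zero, mul_one]
  have hx'le : x' ≤ b' * a t * D - a t * x t := by linarith
  calc Real.exp (ε * A t) * (ε * a t) * x t + Real.exp (ε * A t) * x'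
      ≤ Real.exp (ε * A t) * (ε * a t) * x t
        + Real.exp (ε * A t) * (b' * a t * D - a t * x t) := by gcongr
    _ = a t * ((b' * (Real.exp (ε * A t) * D)) - (1 - ε) * (Real.exp (ε * A t) * x t)) := by ring
    _ = a t * (c * (β' * (1 - ε)) - (1 - ε) * (Real.exp (ε * A t) * x t)) := by
        rw [hED, hβ']; ring
    _ = (1 - ε) * a t * (β' * c - Real.exp (ε * A t) * x t) := by ring

end IsSolution

/-! ### Exponential stability -/

theorem theorem4 (m : ℕ) (hm : 0 < m)
    (a : ℝ → ℝ) (b h : Fin m → ℝ → ℝ) (R : Fin m → ℝ → ℝ → ℝ)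
    -- the coefficients are Lebesgue measurable and essentially bounded on `[0, ∞)`
    (ha : MemLp a ⊤ (volume.restrict (Ici 0)))
    (hb : ∀ k, MemLp (b k) ⊤ (volume.restrict (Ici 0)))
    (a₀ : ℝ) (ha₀ : 0 < a₀) (ha_ge : ∀ t, 0 ≤ t → a₀ ≤ a t)
    (hb_nonneg : ∀ k t, 0 ≤ t → 0 ≤ b k t)
    -- the delay functions
    (hh_meas : ∀ k, AEMeasurable (h k) (volume.restrict (Ici 0)))
    (hh_le : ∀ k t, 0 ≤ t → h k t ≤ t)
    (hh_lim : ∀ k, Tendsto (h k) atTop atTop)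
    -- the distributions of the delays: nondecreasing in `s`, of total mass one
    (hR_mono : ∀ k, ∀ᵐ t ∂(volume.restrict (Ici 0)), Monotone (R k t))
    (hR_mass : ∀ k, ∀ᵐ t ∂(volume.restrict (Ici 0)),
      stieltjesMeasure (R k t) (Icc (h k t) t) = 1)
    -- the two upper limits, assumed finite
    (h₀ β : ℝ)
    (hh₀ : limsup (fun t : ℝ => ((∫ s in (⨅ k, h k t)..t, a s : ℝ) : EReal)) atTop = (h₀ : EReal))
    (hβ : limsup (fun t : ℝ => (((∑ k, b k t) / a t : ℝ) : EReal)) atTop = (β : EReal))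
    -- the stability condition; for `β = 0` its two sides are `+∞` and `-∞`
    (hcond : β = 0 ∨
      1 / β * Real.exp (-h₀) > Real.log ((β ^ 2 + β) / (β ^ 2 + 1))) :
    ExponentiallyStable a b h R := by
  have : Nonempty (Fin m) := ⟨⟨0, hm⟩⟩
  obtain ⟨A, hA, hAlow, hAint⟩ := exists_isClock ha ha₀ ha_ge
  obtain ⟨ε, b', h', β', hε0, hε1, hβb, hb'0, hhh, hh'0, hβ'0, hβ', hexp, hcond'⟩ :=
    exists_perturbed_yorke_condition hcond
  have hε1' : 0 < 1 - ε := by linarith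
  obtain ⟨T, hT0, hTh, hTA, hTb⟩ : ∃ T, 0 ≤ T ∧ (∀ k t, T ≤ t → 0 ≤ h k t) ∧
      (∀ k t, T ≤ t → A t - A (h k t) ≤ h') ∧ ∀ t, T ≤ t → ∑ k, b k t ≤ b' * a t := by
    have e1 := eventually_lt_of_limsup_lt (hh₀.trans_lt (EReal.coe_lt_coe_iff.2 hhh))
    have e2 := eventually_lt_of_limsup_lt (hβ.trans_lt (EReal.coe_lt_coe_iff.2 hβb))
    have e3 := eventually_all.2 fun k => (hh_lim k).eventually_ge_atTop 0
    obtain ⟨T, hT⟩ := eventually_atTop.1 (e1.and (e2.and (e3.and (eventually_ge_atTop 0))))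
    refine ⟨T, (hT T le_rfl).2.2.2, fun k t ht => (hT t ht).2.2.1 k, fun k t ht => ?_,
      fun t ht => ?_⟩
    · obtain ⟨h1, -, h3, h4⟩ := hT t ht
      obtain ⟨j, hj⟩ := exists_eq_ciInf_of_finite (f := fun k => h k t)
      rw [EReal.coe_lt_coe_iff, ← hj, hAint _ _ (h3 j) (hh_le j t h4)] at h1
      have hjk : h j t ≤ h k t := hj.trans_le (ciInf_le (finite_range _).bddBelow k)
      linarith [hA.le (h3 j) hjk]
    · obtain ⟨-, h2, -, h4⟩ := hT t ht
      rw [EReal.coe_lt_coe_iff, div_lt_iff₀ (hA.pos t h4)] at h2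
      exact h2.le
  obtain ⟨Ca, hCa0, hCa⟩ := ha.exists_ae_abs_le
  obtain ⟨Cb, hCb0, hCb⟩ : ∃ Cb, 0 ≤ Cb ∧ ∀ᵐ t, 0 ≤ t → ∑ k, b k t ≤ Cb := by
    choose C hC0 hC using fun k => (hb k).exists_ae_abs_le
    refine ⟨∑ k, C k, Finset.sum_nonneg fun k _ => hC0 k, ?_⟩
    filter_upwards [ae_all_iff.2 hC] with t ht h0
    exact Finset.sum_le_sum fun k _ => (le_abs_self _).trans (ht k h0)
  obtain ⟨K, hK⟩ := hA.lipschitz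
  -- Since `a ≥ a₀`, the clock `(1 - ε) A` advances by at least `2 * h'` between `t₀ + T` and `t₀ +
  -- L`, uniformly in `t₀`.
  set L := T + 2 * h' / ((1 - ε) * a₀) with hL
  have hL0 : 0 ≤ L := by positivity
  refine ⟨Real.exp (ε * (K * L)) * Real.exp ((Ca + Cb) * L), by positivity, ε * a₀,
    by positivity, ?_⟩
  intro t₀ ht₀ φ x hx t ht
  have ht₀L : 0 ≤ t₀ + L := by linarith
  set E := Real.exp ((Ca + Cb) * L) with hE
  have hE1 : 1 ≤ E := Real.one_le_exp (by positivity)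
  have hxL : ∀ u, u ≤ t₀ + L → |x u| ≤ ‖φ‖ * E := by
    intro u hu
    rcases le_total u t₀ with h1 | h1
    · exact (hx.abs_le_norm h1).trans (le_mul_of_one_le_right (norm_nonneg _) hE1)
    · refine (hx.abs_le_exp ht₀ hCa hCb hb_nonneg hR_mass (by positivity) h1).trans ?_
      rw [hE]
      gcongr
      linarith
  have hP := hA.const_mul hε1'
  have ht₁ : 0 ≤ max t₀ T := ht₀.trans (le_max_left _ _)
  have hmaxT : max t₀ T ≤ t₀ + T := max_le (by linarith) (by linarith)
  have hLT : T ≤ L := by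
    rw [hL]
    have : 0 ≤ 2 * h' / ((1 - ε) * a₀) := by positivity
    linarith
  have hEac : ∀ s t, 0 ≤ s → s ≤ t →
      AbsolutelyContinuousOnInterval (fun u => Real.exp (ε * A u)) s t :=
    fun s t => hA.absolutelyContinuous_exp_mul ε
  have hz : ∀ s t, max t₀ T ≤ s → s ≤ t →
      AbsolutelyContinuousOnInterval (fun u => Real.exp (ε * A u) * x u) s t := by
    intro s t hs hst
    have h0s : t₀ ≤ s := (le_max_left _ _).trans hs
    refine (hEac s t (ht₁.trans hs) hst).mul ((hx.absolutelyContinuous t (h0s.trans hst)).mono ?_)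
    rw [uIcc_of_le hst, uIcc_of_le (h0s.trans hst)]
    exact Icc_subset_Icc_left h0s
  have hzc : ContinuousOn (fun u => Real.exp (ε * A u) * x u) (Ici 0) :=
    ((hK.continuousOn.const_mul ε).rexp).mul hx.continuous.continuousOn
  have hY := hx.yorkeUpper hA hε0 hε1 hβ' hT0 hb_nonneg hR_mass hTh hTA hTb
  have hY' : YorkeUpper (fun t => (1 - ε) * A t) (fun t => (1 - ε) * a t) β' h' (max t₀ T)
      (-fun t => Real.exp (ε * A t) * x t) := by
    convert hx.neg.yorkeUpper hA hε0 hε1 hβ' hT0 hb_nonneg hR_mass hTh hTA hTb using 1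
    ext u
    simp
  have hPL : (1 - ε) * A (max t₀ T) + 2 * h' ≤ (1 - ε) * A (t₀ + L) := by
    have h1 := hAlow _ _ ht₁ (hmaxT.trans (by linarith : t₀ + T ≤ t₀ + L))
    have h2 : a₀ * (2 * h' / ((1 - ε) * a₀)) ≤ a₀ * (t₀ + L - max t₀ T) := by
      gcongr
      linarith
    have h3 : (1 - ε) * (a₀ * (2 * h' / ((1 - ε) * a₀))) = 2 * h' := by
      field_simp
    have h4 := mul_le_mul_of_nonneg_left (h2.trans h1) hε1'.le
    linarith
  have hmain := abs_le_of_yorkeUpper hP hβ'0 hh'0 hexp hcond' ht₁ hz hzc hY hY'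
    (hmaxT.trans (by linarith)) hPL (N := Real.exp (ε * A (t₀ + L)) * (‖φ‖ * E)) (by positivity)
    (fun u h0 hu => by
      rw [abs_mul, Real.abs_exp]
      have := hA.le h0 hu
      have := hxL u hu
      gcongr) (ht₀.trans ht)
  rw [abs_mul, Real.abs_exp] at hmain
  have hAK : A (t₀ + L) - A t₀ ≤ K * L := by
    have := hK.dist_le_mul (t₀ + L) ht₀L t₀ ht₀
    rw [Real.dist_eq, Real.dist_eq, add_sub_cancel_left, abs_of_nonneg hL0] at this
    exact (le_abs_self _).trans this
  have hAt := hAlow t₀ t ht₀ ht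
  -- Both bounds are taken relative to `A t₀`, which cancels: this makes `M` independent of `t₀`.
  have h1 : Real.exp (ε * A (t₀ + L)) ≤ Real.exp (ε * A t) *
      (Real.exp (ε * (K * L)) * Real.exp (-(ε * a₀) * (t - t₀))) := by
    rw [← Real.exp_add, ← Real.exp_add]
    refine Real.exp_le_exp.2 ?_
    have := mul_le_mul_of_nonneg_left (add_le_add hAK hAt) hε0.le
    linarith
  refine le_of_mul_le_mul_left (hmain.trans ?_) (Real.exp_pos (ε * A t))
  refine (mul_le_mul_of_nonneg_right h1 (by positivity : 0 ≤ ‖φ‖ * E)).trans_eq ?_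
  ring
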